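/- Let $A\in M_k(\mathbb C)$, $C\in M_l(\mathbb C)$, $E\in M_m(\mathbb C)$, $B\in M_{k\times l}(\mathbb C)$, $D\in M_{l\times m}(\mathbb C)$, and for $X\in M_{k\times m}(\mathbb C)$ put $$H(X)=\begin{pmatrix}A&B&X\\ B^\star&C&D\\ X^\star&D^\star&E\end{pmatrix},\qquad H[\alpha]=\begin{pmatrix}A&B\\ B^\star&C\end{pmatrix},\qquad H[\beta]=\begin{pmatrix}C&D\\ D^\star&E\end{pmatrix}.$$ Write $N(M)$ for the nullspace and $M^+$ for the Moore–Penrose inverse of a matrix $M$. A Hermitian block matrix is said to be of maximal rank if its nullspace is the direct sum of the nullspaces of its diagonal blocks; thus $H[\alpha]$, $H[\beta]$ and $H(X)$ are of maximal rank if $N(H[\alpha])=N(A)\oplus N(C)$, $N(H[\beta])=N(C)\oplus N(E)$ and $N(H(X))=N(A)\oplus N(C)\oplus N(E)$, respectively. Suppose that $H[\alpha]$ and $H[\beta]$ are positive semidefinite and of maximal rank. Then: 1. For $X=BC^+D$ the matrix $H(X)$ is positive semidefinite. 2. $X=BC^+D$ is the unique $X\in M_{k\times m}(\mathbb C)$ for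 which $H(X)$ is of maximal rank and $H(X)^+$ has zeroes in the places where $X$ sits in $H(X)$; that is, $H(X)$ is of maximal rank and the upper right $k\times m$ block of $H(X)^+$ vanishes if and only if $X=BC^+D$. 3. With $H[\alpha]/C=A-BC^+B^\star$ and $H[\beta]/C=E-D^\star C^+D$, for $X=BC^+D$ one has $$H(X)^+=\begin{pmatrix}(H[\alpha]/C)^+&-(H[\alpha]/C)^+BC^+&0\\ -C^+B^\star(H[\alpha]/C)^+&\Xi&-C^+D(H[\beta]/C)^+\\ 0&-(H[\beta]/C)^+D^\star C^+&(H[\beta]/C)^+\end{pmatrix},$$ where $\Xi=C^++C^+B^\star(H[\alpha]/C)^+BC^++C^+D(H[\beta]/C)^+D^\star C^+$. -/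

import Mathlib

open scoped Matrix ComplexOrder

namespace MatrixCompletion

/-- `G` satisfies the four Penrose equations for `M`. -/
structure IsMoorePenrose {m n : Type*} [Fintype m] [Fintype n]
    (M : Matrix m n ℂ) (G : Matrix n m ℂ) : Prop where
  mul_mul_self : M * G * M = M
  self_mul_mul : G * M * G = G
  isHermitian_mul : (M * G).IsHermitian
  isHermitian_mul' : (G * M).IsHermitian

/-- There is at most one Moore–Penrose inverse. -/
theorem IsMoorePenrose.unique {m n : Type*} [Fintype m] [Fintype n]
    {M : Matrix m n ℂ} {G G' : Matrix n m ℂ}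
    (h : IsMoorePenrose M G) (h' : IsMoorePenrose M G') : G = G' := by
  have e1 : M * G = M * G' := by
    calc M * G = (M * G)ᴴ := h.isHermitian_mul.eq.symm
      _ = ((M * G') * (M * G))ᴴ := by rw [← Matrix.mul_assoc, h'.mul_mul_self]
      _ = (M * G)ᴴ * (M * G')ᴴ := Matrix.conjTranspose_mul _ _
      _ = M * G * (M * G') := by rw [h.isHermitian_mul.eq, h'.isHermitian_mul.eq]
      _ = M * G' := by rw [← Matrix.mul_assoc, h.mul_mul_self]
  have e2 : G * M = G' * M := by
    calc G * M = (G * M)ᴴ := h.isHermitian_mul'.eq.symm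
      _ = ((G * M) * (G' * M))ᴴ := by
          rw [Matrix.mul_assoc G M (G' * M), ← Matrix.mul_assoc M G' M, h'.mul_mul_self]
      _ = (G' * M)ᴴ * (G * M)ᴴ := Matrix.conjTranspose_mul _ _
      _ = G' * M * (G * M) := by rw [h.isHermitian_mul'.eq, h'.isHermitian_mul'.eq]
      _ = G' * M := by rw [Matrix.mul_assoc, ← Matrix.mul_assoc M G M, h.mul_mul_self]
  calc G = G * M * G := h.self_mul_mul.symm
    _ = G' * (M * G) := by rw [e2, Matrix.mul_assoc]
    _ = G' := by rw [e1, ← Matrix.mul_assoc, h'.self_mul_mul]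

/-- A Hermitian matrix has a Hermitian Moore–Penrose inverse. -/
theorem exists_isMoorePenrose_of_isHermitian {n : Type*} [Fintype n]
    {M : Matrix n n ℂ} (hM : M.IsHermitian) :
    ∃ G : Matrix n n ℂ, G.IsHermitian ∧ IsMoorePenrose M G := by
  classical
  obtain ⟨U, d, hU, hd⟩ : ∃ (U : Matrix n n ℂ) (d : n → ℝ), Uᴴ * U = 1 ∧
      M = U * Matrix.diagonal (fun i => (d i : ℂ)) * Uᴴ := by
    refine ⟨hM.eigenvectorUnitary, hM.eigenvalues, ?_, ?_⟩
    · exact Unitary.coe_star_mul_self hM.eigenvectorUnitary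
    · exact hM.spectral_theorem
  have hmul : ∀ P Q : Matrix n n ℂ, (U * P * Uᴴ) * (U * Q * Uᴴ) = U * (P * Q) * Uᴴ := by
    intro P Q
    calc (U * P * Uᴴ) * (U * Q * Uᴴ) = U * P * (Uᴴ * U) * Q * Uᴴ := by
          simp only [Matrix.mul_assoc]
      _ = U * (P * Q) * Uᴴ := by rw [hU]; simp only [Matrix.mul_assoc, Matrix.one_mul]
  have hher : ∀ e : n → ℝ, (U * Matrix.diagonal (fun i => (e i : ℂ)) * Uᴴ).IsHermitian := by
    intro e
    apply Matrix.isHermitian_mul_mul_conjTranspose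
    apply Matrix.isHermitian_diagonal_of_self_adjoint
    ext i
    simp
  have key : ∀ e f : n → ℝ, (U * Matrix.diagonal (fun i => (e i : ℂ)) * Uᴴ) *
      (U * Matrix.diagonal (fun i => (f i : ℂ)) * Uᴴ) =
      U * Matrix.diagonal (fun i => ((e i * f i : ℝ) : ℂ)) * Uᴴ := by
    intro e f
    rw [hmul, Matrix.diagonal_mul_diagonal]
    simp
  refine ⟨U * Matrix.diagonal (fun i => (((d i)⁻¹ : ℝ) : ℂ)) * Uᴴ, hher _, ?_⟩
  subst hd
  refine ⟨?_, ?_, ?_, ?_⟩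
  · rw [key, key]
    simp only [mul_inv_mul_cancel]
  · rw [key, key]
    have : ∀ i, (d i)⁻¹ * d i * (d i)⁻¹ = (d i)⁻¹ := fun i => by
      simpa using mul_inv_mul_cancel (d i)⁻¹
    simp only [this]
  · rw [key]; exact hher _
  · rw [key]; exact hher _

/-- Every complex matrix has a Moore–Penrose inverse. -/
theorem exists_isMoorePenrose {m n : Type*} [Fintype m] [Fintype n]
    (M : Matrix m n ℂ) : ∃ G : Matrix n m ℂ, IsMoorePenrose M G := by
  obtain ⟨G, hG, h⟩ :=
    exists_isMoorePenrose_of_isHermitian (Matrix.isHermitian_conjTranspose_mul_self M)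
  have h1 : M * (G * (Mᴴ * M)) = M := by
    classical
    have hz : Mᴴ * M * (G * (Mᴴ * M) - 1) = 0 := by
      rw [Matrix.mul_sub, Matrix.mul_one, ← Matrix.mul_assoc (Mᴴ * M) G, h.mul_mul_self, sub_self]
    have := (Matrix.conjTranspose_mul_self_mul_eq_zero M _).1 hz
    rw [Matrix.mul_sub, Matrix.mul_one] at this
    exact sub_eq_zero.1 this
  refine ⟨G * Mᴴ, ?_, ?_, ?_, ?_⟩
  · simpa only [Matrix.mul_assoc] using h1
  · have := congrArg (· * Mᴴ) h.self_mul_mul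
    simpa only [Matrix.mul_assoc] using this
  · rw [← Matrix.mul_assoc]
    exact Matrix.isHermitian_mul_mul_conjTranspose M hG
  · rw [Matrix.mul_assoc]
    exact h.isHermitian_mul'

/-- The Moore–Penrose inverse `M⁺` of a complex matrix. -/
noncomputable def pinv {m n : Type*} [Fintype m] [Fintype n]
    (M : Matrix m n ℂ) : Matrix n m ℂ :=
  Classical.choose (exists_isMoorePenrose M)

/-- `pinv M` is the matrix characterised by the four Penrose equations. -/
theorem isMoorePenrose_pinv {m n : Type*} [Fintype m] [Fintype n]
    (M : Matrix m n ℂ) : IsMoorePenrose M (pinv M) :=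
  Classical.choose_spec (exists_isMoorePenrose M)

/-- The matrix with three block rows and three block columns. -/
def blocks₃ {k l m : Type*}
    (M₁₁ : Matrix k k ℂ) (M₁₂ : Matrix k l ℂ) (M₁₃ : Matrix k m ℂ)
    (M₂₁ : Matrix l k ℂ) (M₂₂ : Matrix l l ℂ) (M₂₃ : Matrix l m ℂ)
    (M₃₁ : Matrix m k ℂ) (M₃₂ : Matrix m l ℂ) (M₃₃ : Matrix m m ℂ) :
    Matrix (k ⊕ l ⊕ m) (k ⊕ l ⊕ m) ℂ :=
  Matrix.fromBlocks M₁₁ (Matrix.fromCols M₁₂ M₁₃) (Matrix.fromRows M₂₁ M₃₁)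
    (Matrix.fromBlocks M₂₂ M₂₃ M₃₂ M₃₃)

/-- The matrix `[A, B; Bᴴ, C]`. -/
def herm₂ {k l : Type*} (A : Matrix k k ℂ) (B : Matrix k l ℂ) (C : Matrix l l ℂ) :
    Matrix (k ⊕ l) (k ⊕ l) ℂ :=
  Matrix.fromBlocks A B Bᴴ C

/-- The matrix `[A, B, X; Bᴴ, C, D; Xᴴ, Dᴴ, E]`. -/
def herm₃ {k l m : Type*} (A : Matrix k k ℂ) (B : Matrix k l ℂ) (C : Matrix l l ℂ)
    (D : Matrix l m ℂ) (E : Matrix m m ℂ) (X : Matrix k m ℂ) :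
    Matrix (k ⊕ l ⊕ m) (k ⊕ l ⊕ m) ℂ :=
  blocks₃ A B X Bᴴ C D Xᴴ Dᴴ E

/-- A matrix `H` partitioned into two block rows and columns is of maximal rank: its nullspace is
the direct sum of the nullspaces of its two diagonal blocks. -/
def IsMaximalRank₂ {k l : Type*} [Fintype k] [Fintype l]
    (H : Matrix (k ⊕ l) (k ⊕ l) ℂ) : Prop :=
  ∀ (u : k → ℂ) (v : l → ℂ), H *ᵥ Sum.elim u v = 0 ↔
    H.toBlocks₁₁ *ᵥ u = 0 ∧ H.toBlocks₂₂ *ᵥ v = 0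

/-- A matrix `H` partitioned into three block rows and columns is of maximal rank: its nullspace is
the direct sum of the nullspaces of its three diagonal blocks. -/
def IsMaximalRank₃ {k l m : Type*} [Fintype k] [Fintype l] [Fintype m]
    (H : Matrix (k ⊕ l ⊕ m) (k ⊕ l ⊕ m) ℂ) : Prop :=
  ∀ (u : k → ℂ) (v : l → ℂ) (w : m → ℂ), H *ᵥ Sum.elim u (Sum.elim v w) = 0 ↔
    H.toBlocks₁₁ *ᵥ u = 0 ∧ H.toBlocks₂₂.toBlocks₁₁ *ᵥ v = 0 ∧ H.toBlocks₂₂.toBlocks₂₂ *ᵥ w = 0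

/-- The generalized Schur complement `S - R P⁺ Q` of the block `P` in `[P, Q; R, S]`. -/
noncomputable def schurCompl {p q : Type*} [Fintype p]
    (P : Matrix p p ℂ) (Q : Matrix p q ℂ) (R : Matrix q p ℂ) (S : Matrix q q ℂ) :
    Matrix q q ℂ :=
  S - R * pinv P * Q

end MatrixCompletion

/-! Write G = C⁺, S = H[α]/C, T = H[β]/C. Maximal rank of the 2×2 blocks gives B G C = B and C G D =
D, and it makes S, T have the kernels of A, E, hence S⁺S = A⁺A and T⁺T = E⁺E. For X = B G D, H is
congruent to diag(S, C, T) (`posSemidef_completion`). The block formula K satisfies H K = diag(SS⁺,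
CC⁺, TT⁺) (`completion_mul_completionPinv`), which yields the Penrose equations and, comparing
kernels, maximal rank. Conversely, maximal rank forces H H⁺ = diag(A⁺A, C⁺C, E⁺E). If the corner of
H⁺ vanishes, eliminating the middle block from the last block column of this identity gives (X - B G
D) E⁺E = 0, and E⁺E is absorbed by both X and D (`eq_of_isMaximalRank₃`). -/

namespace MatrixCompletion

/-! ### Moore–Penrose inverses and kernels -/

section Pinv

variable {m n p : Type*} [Fintype m] [Fintype n]

theorem pinv_eq {M : Matrix m n ℂ} {G : Matrix n m ℂ} (h : IsMoorePenrose M G) : pinv M = G :=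
  (isMoorePenrose_pinv M).unique h

theorem isHermitian_pinv {M : Matrix n n ℂ} (hM : M.IsHermitian) : (pinv M).IsHermitian := by
  obtain ⟨G, hG, h⟩ := exists_isMoorePenrose_of_isHermitian hM
  rwa [pinv_eq h]

theorem mul_pinv_comm {M : Matrix n n ℂ} (hM : M.IsHermitian) : M * pinv M = pinv M * M := by
  have h := (isMoorePenrose_pinv M).isHermitian_mul.eq
  rw [Matrix.conjTranspose_mul, hM.eq, (isHermitian_pinv hM).eq] at h
  exact h.symm

/-- If the kernel of `M` is contained in that of `N`, then `N` absorbs the projection `M⁺ M`. -/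
theorem mul_pinv_mul_of_ker_le {M : Matrix m n ℂ} {N : Matrix p n ℂ}
    (h : ∀ v, M *ᵥ v = 0 → N *ᵥ v = 0) : N * (pinv M * M) = N := by
  classical
  refine Matrix.ext_of_mulVec_single fun i => ?_
  -- The columns of M⁺M - 1 lie in the kernel of M.
  have h1 : M *ᵥ ((pinv M * M) *ᵥ Pi.single i 1 - Pi.single i 1) = 0 := by
    rw [Matrix.mulVec_sub, Matrix.mulVec_mulVec, ← Matrix.mul_assoc,
      (isMoorePenrose_pinv M).mul_mul_self, sub_self]
  have h2 := h _ h1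
  rw [Matrix.mulVec_sub, Matrix.mulVec_mulVec] at h2
  exact sub_eq_zero.1 h2

theorem pinv_mul_mulVec_eq_zero_iff (M : Matrix m n ℂ) (v : n → ℂ) :
    (pinv M * M) *ᵥ v = 0 ↔ M *ᵥ v = 0 := by
  constructor <;> intro h
  · have := congrArg (M *ᵥ ·) h
    simpa only [Matrix.mulVec_mulVec, ← Matrix.mul_assoc, (isMoorePenrose_pinv M).mul_mul_self,
      Matrix.mulVec_zero] using this
  · rw [← Matrix.mulVec_mulVec, h, Matrix.mulVec_zero]

/-- Matrices with the same kernel have the same projection `M⁺ M`. -/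
theorem pinv_mul_eq_of_ker_eq [Fintype p] {M : Matrix m n ℂ} {N : Matrix p n ℂ}
    (h : ∀ v, M *ᵥ v = 0 ↔ N *ᵥ v = 0) : pinv M * M = pinv N * N := by
  have h1 : pinv N * N * (pinv M * M) = pinv N * N := by
    rw [Matrix.mul_assoc, mul_pinv_mul_of_ker_le fun v => (h v).1]
  have h2 : pinv M * M * (pinv N * N) = pinv M * M := by
    rw [Matrix.mul_assoc, mul_pinv_mul_of_ker_le fun v => (h v).2]
  -- Both projections are Hermitian, so the adjoint of QP = Q reads PQ = Q, while PQ = P.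
  have h3 := congrArg Matrix.conjTranspose h1
  rw [Matrix.conjTranspose_mul, (isMoorePenrose_pinv N).isHermitian_mul'.eq,
    (isMoorePenrose_pinv M).isHermitian_mul'.eq, h2] at h3
  exact h3

/-- Lets a triple-product identity fire inside longer right-associated products. -/
theorem mul_reassoc {m n p q r : Type*} [Fintype n] [Fintype p] [Fintype q] {X : Matrix m n ℂ}
    {Y : Matrix n p ℂ} {Z : Matrix p q ℂ} {W : Matrix m q ℂ} (h : X * (Y * Z) = W)
    (V : Matrix q r ℂ) : X * (Y * (Z * V)) = W * V := by
  rw [← h, Matrix.mul_assoc, Matrix.mul_assoc]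

end Pinv

/-! ### Calculus of 3×3 block matrices -/

section Blocks

variable {k l m : Type*}

theorem blocks₃_conjTranspose
    (M₁₁ : Matrix k k ℂ) (M₁₂ : Matrix k l ℂ) (M₁₃ : Matrix k m ℂ)
    (M₂₁ : Matrix l k ℂ) (M₂₂ : Matrix l l ℂ) (M₂₃ : Matrix l m ℂ)
    (M₃₁ : Matrix m k ℂ) (M₃₂ : Matrix m l ℂ) (M₃₃ : Matrix m m ℂ) :
    (blocks₃ M₁₁ M₁₂ M₁₃ M₂₁ M₂₂ M₂₃ M₃₁ M₃₂ M₃₃)ᴴ =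
      blocks₃ M₁₁ᴴ M₂₁ᴴ M₃₁ᴴ M₁₂ᴴ M₂₂ᴴ M₃₂ᴴ M₁₃ᴴ M₂₃ᴴ M₃₃ᴴ := by
  ext i j
  rcases i with i | i | i <;> rcases j with j | j | j <;> rfl

theorem blocks₃_mul [Fintype k] [Fintype l] [Fintype m]
    (M₁₁ : Matrix k k ℂ) (M₁₂ : Matrix k l ℂ) (M₁₃ : Matrix k m ℂ)
    (M₂₁ : Matrix l k ℂ) (M₂₂ : Matrix l l ℂ) (M₂₃ : Matrix l m ℂ)
    (M₃₁ : Matrix m k ℂ) (M₃₂ : Matrix m l ℂ) (M₃₃ : Matrix m m ℂ)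
    (N₁₁ : Matrix k k ℂ) (N₁₂ : Matrix k l ℂ) (N₁₃ : Matrix k m ℂ)
    (N₂₁ : Matrix l k ℂ) (N₂₂ : Matrix l l ℂ) (N₂₃ : Matrix l m ℂ)
    (N₃₁ : Matrix m k ℂ) (N₃₂ : Matrix m l ℂ) (N₃₃ : Matrix m m ℂ) :
    blocks₃ M₁₁ M₁₂ M₁₃ M₂₁ M₂₂ M₂₃ M₃₁ M₃₂ M₃₃ *
        blocks₃ N₁₁ N₁₂ N₁₃ N₂₁ N₂₂ N₂₃ N₃₁ N₃₂ N₃₃ =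
      blocks₃
        (M₁₁ * N₁₁ + M₁₂ * N₂₁ + M₁₃ * N₃₁) (M₁₁ * N₁₂ + M₁₂ * N₂₂ + M₁₃ * N₃₂)
        (M₁₁ * N₁₃ + M₁₂ * N₂₃ + M₁₃ * N₃₃)
        (M₂₁ * N₁₁ + M₂₂ * N₂₁ + M₂₃ * N₃₁) (M₂₁ * N₁₂ + M₂₂ * N₂₂ + M₂₃ * N₃₂)
        (M₂₁ * N₁₃ + M₂₂ * N₂₃ + M₂₃ * N₃₃)
        (M₃₁ * N₁₁ + M₃₂ * N₂₁ + M₃₃ * N₃₁) (M₃₁ * N₁₂ + M₃₂ * N₂₂ + M₃₃ * N₃₂)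
        (M₃₁ * N₁₃ + M₃₂ * N₂₃ + M₃₃ * N₃₃) := by
  ext i j
  rcases i with i | i | i <;> rcases j with j | j | j <;>
    simp [blocks₃, Matrix.mul_apply, Fintype.sum_sum_type, add_assoc]

theorem blocks₃_mulVec [Fintype k] [Fintype l] [Fintype m]
    (M₁₁ : Matrix k k ℂ) (M₁₂ : Matrix k l ℂ) (M₁₃ : Matrix k m ℂ)
    (M₂₁ : Matrix l k ℂ) (M₂₂ : Matrix l l ℂ) (M₂₃ : Matrix l m ℂ)
    (M₃₁ : Matrix m k ℂ) (M₃₂ : Matrix m l ℂ) (M₃₃ : Matrix m m ℂ)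
    (u : k → ℂ) (v : l → ℂ) (w : m → ℂ) :
    blocks₃ M₁₁ M₁₂ M₁₃ M₂₁ M₂₂ M₂₃ M₃₁ M₃₂ M₃₃ *ᵥ Sum.elim u (Sum.elim v w) =
      Sum.elim (M₁₁ *ᵥ u + M₁₂ *ᵥ v + M₁₃ *ᵥ w)
        (Sum.elim (M₂₁ *ᵥ u + M₂₂ *ᵥ v + M₂₃ *ᵥ w) (M₃₁ *ᵥ u + M₃₂ *ᵥ v + M₃₃ *ᵥ w)) := by
  ext i
  rcases i with i | i | i <;>
    simp [blocks₃, Matrix.mulVec, dotProduct, Fintype.sum_sum_type, add_assoc]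

theorem exists_eq_blocks₃ (M : Matrix (k ⊕ l ⊕ m) (k ⊕ l ⊕ m) ℂ) :
    ∃ M₁₁ M₁₂ M₁₃ M₂₁ M₂₂ M₂₃ M₃₁ M₃₂ M₃₃,
      M = blocks₃ M₁₁ M₁₂ M₁₃ M₂₁ M₂₂ M₂₃ M₃₁ M₃₂ M₃₃ := by
  refine ⟨M.toBlocks₁₁, .of fun i j => M (.inl i) (.inr (.inl j)),
    .of fun i j => M (.inl i) (.inr (.inr j)), .of fun i j => M (.inr (.inl i)) (.inl j),
    M.toBlocks₂₂.toBlocks₁₁, M.toBlocks₂₂.toBlocks₁₂,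
    .of fun i j => M (.inr (.inr i)) (.inl j), M.toBlocks₂₂.toBlocks₂₁,
    M.toBlocks₂₂.toBlocks₂₂, ?_⟩
  ext i j
  rcases i with i | i | i <;> rcases j with j | j | j <;> rfl

theorem blocks₃_inj
    {M₁₁ : Matrix k k ℂ} {M₁₂ : Matrix k l ℂ} {M₁₃ : Matrix k m ℂ}
    {M₂₁ : Matrix l k ℂ} {M₂₂ : Matrix l l ℂ} {M₂₃ : Matrix l m ℂ}
    {M₃₁ : Matrix m k ℂ} {M₃₂ : Matrix m l ℂ} {M₃₃ : Matrix m m ℂ}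
    {N₁₁ : Matrix k k ℂ} {N₁₂ : Matrix k l ℂ} {N₁₃ : Matrix k m ℂ}
    {N₂₁ : Matrix l k ℂ} {N₂₂ : Matrix l l ℂ} {N₂₃ : Matrix l m ℂ}
    {N₃₁ : Matrix m k ℂ} {N₃₂ : Matrix m l ℂ} {N₃₃ : Matrix m m ℂ} :
    blocks₃ M₁₁ M₁₂ M₁₃ M₂₁ M₂₂ M₂₃ M₃₁ M₃₂ M₃₃ =
        blocks₃ N₁₁ N₁₂ N₁₃ N₂₁ N₂₂ N₂₃ N₃₁ N₃₂ N₃₃ ↔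
      (M₁₁ = N₁₁ ∧ M₁₂ = N₁₂ ∧ M₁₃ = N₁₃) ∧ (M₂₁ = N₂₁ ∧ M₂₂ = N₂₂ ∧ M₂₃ = N₂₃) ∧
        M₃₁ = N₃₁ ∧ M₃₂ = N₃₂ ∧ M₃₃ = N₃₃ := by
  simp only [blocks₃, Matrix.fromBlocks_inj, Matrix.fromCols_inj.eq_iff,
    Matrix.fromRows_inj.eq_iff]
  tauto

theorem exists_eq_sumElim (x : k ⊕ l ⊕ m → ℂ) : ∃ u v w, x = Sum.elim u (Sum.elim v w) :=
  ⟨fun i => x (.inl i), fun i => x (.inr (.inl i)), fun i => x (.inr (.inr i)), by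
    ext i; rcases i with i | i | i <;> rfl⟩

theorem sumElim_eq_zero {u : k → ℂ} {v : l → ℂ} :
    Sum.elim u v = 0 ↔ u = 0 ∧ v = 0 := by
  simp [funext_iff]

variable [Fintype k] [Fintype l] [Fintype m]

theorem isMoorePenrose_diag (P : Matrix k k ℂ) (Q : Matrix l l ℂ) (R : Matrix m m ℂ) :
    IsMoorePenrose (blocks₃ P 0 0 0 Q 0 0 0 R)
      (blocks₃ (pinv P) 0 0 0 (pinv Q) 0 0 0 (pinv R)) := by
  have hP := isMoorePenrose_pinv P
  have hQ := isMoorePenrose_pinv Q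
  have hR := isMoorePenrose_pinv R
  constructor
  · simp [blocks₃_mul, hP.mul_mul_self, hQ.mul_mul_self, hR.mul_mul_self]
  · simp [blocks₃_mul, hP.self_mul_mul, hQ.self_mul_mul, hR.self_mul_mul]
  · simp only [blocks₃_mul, Matrix.IsHermitian, blocks₃_conjTranspose]
    simp [-Matrix.conjTranspose_mul, hP.isHermitian_mul.eq, hQ.isHermitian_mul.eq,
      hR.isHermitian_mul.eq]
  · simp only [blocks₃_mul, Matrix.IsHermitian, blocks₃_conjTranspose]
    simp [-Matrix.conjTranspose_mul, hP.isHermitian_mul'.eq, hQ.isHermitian_mul'.eq,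
      hR.isHermitian_mul'.eq]

/-- Maximal rank means that H has the kernel of diag(A, C, E), and the kernel determines the
projection M⁺M. -/
theorem pinv_mul_of_isMaximalRank₃ {A : Matrix k k ℂ} {B : Matrix k l ℂ} {C : Matrix l l ℂ}
    {D : Matrix l m ℂ} {E : Matrix m m ℂ} {X : Matrix k m ℂ}
    (h : IsMaximalRank₃ (herm₃ A B C D E X)) :
    pinv (herm₃ A B C D E X) * herm₃ A B C D E X =
      blocks₃ (pinv A * A) 0 0 0 (pinv C * C) 0 0 0 (pinv E * E) := by
  rw [pinv_mul_eq_of_ker_eq (N := blocks₃ A 0 0 0 C 0 0 0 E), pinv_eq (isMoorePenrose_diag A C E)]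
  · simp [blocks₃_mul]
  · intro x
    obtain ⟨u, v, w, rfl⟩ := exists_eq_sumElim x
    rw [h u v w, blocks₃_mulVec]
    simp [sumElim_eq_zero, herm₃, blocks₃]

end Blocks

/-! ### Schur complements under maximal rank -/

section TwoBlocks

variable {k l : Type*} {A : Matrix k k ℂ} {B : Matrix k l ℂ} {C : Matrix l l ℂ}

theorem isHermitian_of_herm₂ (h : (herm₂ A B C).IsHermitian) :
    A.IsHermitian ∧ C.IsHermitian := by
  rw [herm₂, Matrix.isHermitian_fromBlocks_iff] at h
  exact ⟨h.1, h.2.2.2⟩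

/-- Moves C to the last position, so that results on H[α]/C also serve H[β]/C. -/
theorem posSemidef_herm₂_swap (h : (herm₂ A B C).PosSemidef) : (herm₂ C Bᴴ A).PosSemidef := by
  have := h.submatrix (Sum.swap : l ⊕ k → k ⊕ l)
  simpa [herm₂] using this

variable [Fintype k] [Fintype l]

theorem herm₂_mulVec (u : k → ℂ) (v : l → ℂ) :
    herm₂ A B C *ᵥ Sum.elim u v = Sum.elim (A *ᵥ u + B *ᵥ v) (Bᴴ *ᵥ u + C *ᵥ v) := by
  simp [herm₂, Matrix.fromBlocks_mulVec]

theorem isMaximalRank₂_herm₂_iff :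
    IsMaximalRank₂ (herm₂ A B C) ↔ ∀ u v, (A *ᵥ u + B *ᵥ v = 0 ∧ Bᴴ *ᵥ u + C *ᵥ v = 0) ↔
      A *ᵥ u = 0 ∧ C *ᵥ v = 0 := by
  simp only [IsMaximalRank₂, herm₂_mulVec, sumElim_eq_zero]
  simp [herm₂]

/-- For v in the kernel of C, the vector (0, v) is killed by the whole matrix, and its first row
then says Bv = 0. -/
theorem mul_pinv_mul_of_isMaximalRank₂ (h : IsMaximalRank₂ (herm₂ A B C)) :
    B * (pinv C * C) = B := by
  rw [isMaximalRank₂_herm₂_iff] at h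
  refine mul_pinv_mul_of_ker_le fun v hv => ?_
  simpa using ((h 0 v).2 ⟨by simp, hv⟩).1

theorem mul_pinv_mul_conjTranspose_of_isMaximalRank₂ (hC : C.IsHermitian)
    (h : IsMaximalRank₂ (herm₂ A B C)) : C * pinv C * Bᴴ = Bᴴ := by
  have := congrArg Matrix.conjTranspose (mul_pinv_mul_of_isMaximalRank₂ h)
  rwa [Matrix.conjTranspose_mul, (isMoorePenrose_pinv C).isHermitian_mul'.eq,
    ← mul_pinv_comm hC] at this

/-- The Schur complement of `C` in `[A, B; Bᴴ, C]` has the same kernel as `A`. -/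
theorem schurCompl_mulVec_eq_zero_iff (hC : C.IsHermitian) (h : IsMaximalRank₂ (herm₂ A B C))
    (u : k → ℂ) : schurCompl C Bᴴ B A *ᵥ u = 0 ↔ A *ᵥ u = 0 := by
  have h1 := mul_pinv_mul_conjTranspose_of_isMaximalRank₂ hC h
  rw [isMaximalRank₂_herm₂_iff] at h
  constructor <;> intro hu
  -- The vector (u, -C⁺Bᴴu) solves the second row, and the first row then equals Su.
  · refine ((h u (-((pinv C * Bᴴ) *ᵥ u))).1 ⟨?_, ?_⟩).1
    · rw [schurCompl, Matrix.sub_mulVec] at hu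
      rw [Matrix.mulVec_neg, Matrix.mulVec_mulVec, ← Matrix.mul_assoc, ← sub_eq_add_neg, hu]
    · rw [Matrix.mulVec_neg, Matrix.mulVec_mulVec, ← Matrix.mul_assoc, h1, add_neg_cancel]
  · have h2 : Bᴴ *ᵥ u = 0 := by simpa using ((h u 0).2 ⟨hu, by simp⟩).2
    rw [schurCompl, Matrix.sub_mulVec, hu, ← Matrix.mulVec_mulVec, h2, Matrix.mulVec_zero,
      sub_zero]

theorem pinv_schurCompl_mul (hC : C.IsHermitian) (h : IsMaximalRank₂ (herm₂ A B C)) :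
    pinv (schurCompl C Bᴴ B A) * schurCompl C Bᴴ B A = pinv A * A :=
  pinv_mul_eq_of_ker_eq (schurCompl_mulVec_eq_zero_iff hC h)

theorem posSemidef_schurCompl (h : (herm₂ A B C).PosSemidef)
    (h' : IsMaximalRank₂ (herm₂ A B C)) : (schurCompl C Bᴴ B A).PosSemidef := by
  classical
  have hC := (isHermitian_of_herm₂ h.isHermitian).2
  have h1 := mul_pinv_mul_conjTranspose_of_isMaximalRank₂ hC h'
  -- Compressing by the row (1, -BC⁺) produces exactly the Schur complement.
  have h2 := h.mul_mul_conjTranspose_same (Matrix.fromCols 1 (-(B * pinv C)))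
  convert h2 using 1
  rw [herm₂, Matrix.fromCols_mul_fromBlocks, Matrix.conjTranspose_fromCols_eq_fromRows_conjTranspose,
    Matrix.fromCols_mul_fromRows]
  simp only [schurCompl, Matrix.one_mul, Matrix.conjTranspose_one, Matrix.mul_one,
    Matrix.conjTranspose_neg, Matrix.conjTranspose_mul, (isHermitian_pinv hC).eq, Matrix.neg_mul,
    Matrix.mul_neg, Matrix.add_mul, Matrix.mul_assoc] at h1 ⊢
  rw [h1]
  abel

theorem isMaximalRank₂_herm₂_swap (h : IsMaximalRank₂ (herm₂ A B C)) :
    IsMaximalRank₂ (herm₂ C Bᴴ A) := by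
  rw [isMaximalRank₂_herm₂_iff] at h ⊢
  intro u v
  rw [Matrix.conjTranspose_conjTranspose, add_comm, add_comm (B *ᵥ u), and_comm, h v u, and_comm]

end TwoBlocks

/-! ### The completion X = B C⁺ D and its inverse -/

section Completion

variable {k l m : Type*}
  {S : Matrix k k ℂ} {B : Matrix k l ℂ} {C G : Matrix l l ℂ} {D : Matrix l m ℂ}
  {T : Matrix m m ℂ}

theorem isHermitian_herm₃ {A : Matrix k k ℂ} {E : Matrix m m ℂ} (hA : A.IsHermitian)
    (hC : C.IsHermitian) (hE : E.IsHermitian) (X : Matrix k m ℂ) :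
    (herm₃ A B C D E X).IsHermitian := by
  simp [Matrix.IsHermitian, herm₃, blocks₃_conjTranspose, hA.eq, hC.eq, hE.eq]

variable [Fintype k] [Fintype l] [Fintype m]

/-- Block `LDLᴴ` factorisation of the completion. -/
theorem posSemidef_completion (hS : S.PosSemidef) (hC : C.PosSemidef) (hT : T.PosSemidef)
    (hG : G.IsHermitian) (h1 : B * (G * C) = B) (h2 : C * (G * D) = D) :
    (herm₃ (S + B * G * Bᴴ) B C D (T + Dᴴ * G * D) (B * G * D)).PosSemidef := by
  classical
  have hd : (blocks₃ S 0 0 0 C 0 0 0 T).PosSemidef := by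
    refine .of_dotProduct_mulVec_nonneg ?_ fun x => ?_
    · simp [Matrix.IsHermitian, blocks₃_conjTranspose, hS.isHermitian.eq, hC.isHermitian.eq,
        hT.isHermitian.eq]
    · obtain ⟨u, v, w, rfl⟩ := exists_eq_sumElim x
      have := add_nonneg (hS.dotProduct_mulVec_nonneg u)
        (add_nonneg (hC.dotProduct_mulVec_nonneg v) (hT.dotProduct_mulVec_nonneg w))
      simpa [blocks₃_mulVec, dotProduct, Fintype.sum_sum_type] using this
  -- The outer factor eliminates the first and third blocks against the middle one.
  have h := hd.mul_mul_conjTranspose_same (blocks₃ 1 (B * G) 0 0 1 0 0 (Dᴴ * G) 1)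
  have h3 : C * (G * Bᴴ) = Bᴴ := by
    have := congrArg Matrix.conjTranspose h1
    simpa [hG.eq, hC.isHermitian.eq, Matrix.mul_assoc] using this
  have h4 : Dᴴ * (G * C) = Dᴴ := by
    have := congrArg Matrix.conjTranspose h2
    simpa [hG.eq, hC.isHermitian.eq, Matrix.mul_assoc] using this
  convert h using 1
  simp [herm₃, blocks₃_conjTranspose, blocks₃_mul, hG.eq, Matrix.mul_assoc, h1, h2, h3, h4,
    add_comm]

variable (B D) in
/-- The block formula for the Moore–Penrose inverse of the completion. -/
noncomputable def completionPinv (S : Matrix k k ℂ) (G : Matrix l l ℂ) (T : Matrix m m ℂ) :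
    Matrix (k ⊕ l ⊕ m) (k ⊕ l ⊕ m) ℂ :=
  blocks₃ (pinv S) (-(pinv S * B * G)) 0
    (-(G * Bᴴ * pinv S))
    (G + G * Bᴴ * pinv S * B * G + G * D * pinv T * Dᴴ * G)
    (-(G * D * pinv T)) 0 (-(pinv T * Dᴴ * G)) (pinv T)

theorem isHermitian_completionPinv (hS : S.IsHermitian) (hG : G.IsHermitian)
    (hT : T.IsHermitian) : (completionPinv B D S G T).IsHermitian := by
  simp [Matrix.IsHermitian, completionPinv, blocks₃_conjTranspose, (isHermitian_pinv hS).eq,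
    hG.eq, (isHermitian_pinv hT).eq, Matrix.mul_assoc]

/-- This product serves twice: for the Penrose equations and for the maximal rank of the completion.
-/
theorem completion_mul_completionPinv (hC : C.IsHermitian) (hG : G.IsHermitian)
    (hB : S * (pinv S * B) = B) (hBC : B * (G * C) = B)
    (hD : T * (pinv T * Dᴴ) = Dᴴ) (hCD : C * (G * D) = D) :
    herm₃ (S + B * G * Bᴴ) B C D (T + Dᴴ * G * D) (B * G * D) * completionPinv B D S G T =
      blocks₃ (S * pinv S) 0 0 0 (C * G) 0 0 0 (T * pinv T) := by
  have hB' : C * (G * Bᴴ) = Bᴴ := by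
    have := congrArg Matrix.conjTranspose hBC
    simpa [hC.eq, hG.eq, Matrix.mul_assoc] using this
  simp [completionPinv, herm₃, blocks₃_mul, blocks₃_inj, hG.eq, Matrix.mul_assoc, Matrix.add_mul,
    Matrix.mul_add, mul_reassoc hB, mul_reassoc hB', mul_reassoc hD, mul_reassoc hCD]
  refine ⟨?_, ?_, ?_⟩ <;> abel

theorem isMoorePenrose_completionPinv (hS : S.IsHermitian) (hC : C.IsHermitian)
    (hT : T.IsHermitian)
    (hB : S * (pinv S * B) = B) (hBC : B * (pinv C * C) = B)
    (hD : T * (pinv T * Dᴴ) = Dᴴ) (hCD : C * (pinv C * D) = D) :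
    IsMoorePenrose
      (herm₃ (S + B * pinv C * Bᴴ) B C D (T + Dᴴ * pinv C * D) (B * pinv C * D))
      (completionPinv B D S (pinv C) T) := by
  have hG := isHermitian_pinv hC
  have hB' : C * (pinv C * Bᴴ) = Bᴴ := by
    have := congrArg Matrix.conjTranspose hBC
    simpa [hC.eq, hG.eq, Matrix.mul_assoc] using this
  have hHK := completion_mul_completionPinv hC hG hB hBC hD hCD
  have hH : (herm₃ (S + B * pinv C * Bᴴ) B C D (T + Dᴴ * pinv C * D)
      (B * pinv C * D)).IsHermitian := by
    refine isHermitian_herm₃ ?_ hC ?_ _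
    · simp [Matrix.IsHermitian, hS.eq, hG.eq, Matrix.mul_assoc]
    · simp [Matrix.IsHermitian, hT.eq, hG.eq, Matrix.mul_assoc]
  have hK : (completionPinv B D S (pinv C) T).IsHermitian := isHermitian_completionPinv hS hG hT
  have hP : (blocks₃ (S * pinv S) 0 0 0 (C * pinv C) 0 0 0 (T * pinv T)).IsHermitian := by
    simp [Matrix.IsHermitian, blocks₃_conjTranspose, -Matrix.conjTranspose_mul,
      (isMoorePenrose_pinv _).isHermitian_mul.eq]
  -- H, K and H K are all Hermitian, so K H is the same projection.
  have hKH := congrArg Matrix.conjTranspose hHK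
  rw [Matrix.conjTranspose_mul, hH.eq, hK.eq, hP.eq] at hKH
  refine ⟨?_, ?_, by rwa [hHK], by rwa [hKH]⟩
  · rw [hHK]
    simp [herm₃, blocks₃_mul, blocks₃_inj, Matrix.mul_assoc, Matrix.mul_add, mul_reassoc hB, hB,
      hB', hD, hCD, hG.eq, mul_reassoc hD]
    simp [← Matrix.mul_assoc, (isMoorePenrose_pinv _).mul_mul_self]
  · rw [hKH]
    simp only [mul_pinv_comm hS, mul_pinv_comm hC, mul_pinv_comm hT]
    have e1 := (isMoorePenrose_pinv S).self_mul_mul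
    have e2 := (isMoorePenrose_pinv C).self_mul_mul
    have e3 := (isMoorePenrose_pinv T).self_mul_mul
    rw [Matrix.mul_assoc] at e1 e2 e3
    simp [completionPinv, blocks₃_mul, Matrix.mul_assoc, Matrix.mul_add, e1, e2, e3,
      mul_reassoc e1, mul_reassoc e2, mul_reassoc e3]

/-- Uniqueness of the completion of maximal rank with vanishing corner in the inverse. -/
theorem eq_of_isMaximalRank₃ {A : Matrix k k ℂ} {E : Matrix m m ℂ} {X : Matrix k m ℂ}
    (hA : A.IsHermitian) (hC : C.IsHermitian) (hE : E.IsHermitian)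
    (hBC : B * (G * C) = B) (hCG : C * (G * D) = D) (hG : G.IsHermitian)
    (hT : E - Dᴴ * G * D = T) (hDE : D * (pinv E * E) = D)
    (h : IsMaximalRank₃ (herm₃ A B C D E X))
    (h0 : ∀ i j, pinv (herm₃ A B C D E X) (Sum.inl i) (Sum.inr (Sum.inr j)) = 0) :
    X = B * G * D := by
  have hH := isHermitian_herm₃ (B := B) (D := D) hA hC hE X
  have hK := isHermitian_pinv hH
  have hP := pinv_mul_of_isMaximalRank₃ h
  rw [← mul_pinv_comm hH] at hP
  -- If Ew = 0, then (0, 0, w) is in the kernel of H, whose first row gives Xw = 0.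
  have hX : X * (pinv E * E) = X := mul_pinv_mul_of_ker_le fun w hw => by
    have := (h 0 0 w).2 ⟨by simp, by simp, by simpa [herm₃, blocks₃] using hw⟩
    rw [herm₃, blocks₃_mulVec, sumElim_eq_zero] at this
    simpa using this.1
  generalize pinv (herm₃ A B C D E X) = K at h0 hP hK
  obtain ⟨K₁₁, K₁₂, K₁₃, K₂₁, K₂₂, K₂₃, K₃₁, K₃₂, K₃₃, rfl⟩ := exists_eq_blocks₃ K
  obtain rfl : K₁₃ = 0 := Matrix.ext h0
  rw [Matrix.IsHermitian, blocks₃_conjTranspose, blocks₃_inj] at hK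
  rw [herm₃, blocks₃_mul, blocks₃_inj] at hP
  -- With K₁₃ = 0, the third block column of H K involves only K₂₃ and K₃₃.
  obtain ⟨⟨-, -, h13⟩, ⟨-, -, h23⟩, -, -, h33⟩ := hP
  have hK33 : K₃₃ᴴ = K₃₃ := hK.2.2.2.2
  simp only [Matrix.mul_zero, zero_add] at h13 h23 h33
  have hGD : Dᴴ * (G * C) = Dᴴ := by
    have := congrArg Matrix.conjTranspose hCG
    simpa [hC.eq, hG.eq, Matrix.mul_assoc] using this
  have hCK : C * K₂₃ = -(D * K₃₃) := eq_neg_of_add_eq_zero_left h23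
  have hBK : B * K₂₃ = -(B * (G * (D * K₃₃))) := by
    rw [← mul_reassoc hBC, hCK]
    simp
  have hDK : Dᴴ * K₂₃ = -(Dᴴ * (G * (D * K₃₃))) := by
    rw [← mul_reassoc hGD, hCK]
    simp
  have hY : (X - B * G * D) * K₃₃ = 0 := by
    rw [hBK] at h13
    rw [Matrix.sub_mul, ← h13]
    simp only [Matrix.mul_assoc]
    abel
  have hTK : T * K₃₃ = pinv E * E := by
    rw [← hT, ← h33, hDK, Matrix.sub_mul]
    simp only [Matrix.mul_assoc]
    abel
  -- The adjoint puts K₃₃ on the left, so (X - B G D) K₃₃ = 0 can be multiplied by T.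
  have hKT : K₃₃ * T = pinv E * E := by
    have := congrArg Matrix.conjTranspose hTK
    rwa [(isMoorePenrose_pinv E).isHermitian_mul'.eq, Matrix.conjTranspose_mul, hK33,
      show Tᴴ = T by simp [← hT, hE.eq, hG.eq, Matrix.mul_assoc]] at this
  have : (X - B * G * D) * (pinv E * E) = 0 := by
    rw [← hKT, ← Matrix.mul_assoc, hY, Matrix.zero_mul]
  rw [Matrix.sub_mul, hX, Matrix.mul_assoc (B * G), hDE] at this
  exact sub_eq_zero.1 this

/-- The completion is of maximal rank. -/
theorem isMaximalRank₃_of_pinv_mul {A : Matrix k k ℂ} {E : Matrix m m ℂ} {X : Matrix k m ℂ}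
    (h : pinv (herm₃ A B C D E X) * herm₃ A B C D E X =
      blocks₃ (pinv A * A) 0 0 0 (pinv C * C) 0 0 0 (pinv E * E)) :
    IsMaximalRank₃ (herm₃ A B C D E X) := by
  intro u v w
  rw [← pinv_mul_mulVec_eq_zero_iff, h, blocks₃_mulVec]
  simp [sumElim_eq_zero, pinv_mul_mulVec_eq_zero_iff, herm₃, blocks₃]

end Completion

end MatrixCompletion

theorem mainTheorem2 {k l m : Type*} [Fintype k] [Fintype l] [Fintype m]
    (A : Matrix k k ℂ) (B : Matrix k l ℂ) (C : Matrix l l ℂ)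
    (D : Matrix l m ℂ) (E : Matrix m m ℂ)
    (hα : (MatrixCompletion.herm₂ A B C).PosSemidef)
    (hα' : MatrixCompletion.IsMaximalRank₂ (MatrixCompletion.herm₂ A B C))
    (hβ : (MatrixCompletion.herm₂ C D E).PosSemidef)
    (hβ' : MatrixCompletion.IsMaximalRank₂ (MatrixCompletion.herm₂ C D E)) :
    -- the choice `X = B C⁺ D` gives a positive semidefinite matrix
    (MatrixCompletion.herm₃ A B C D E (B * MatrixCompletion.pinv C * D)).PosSemidef ∧
    -- it is the only choice giving maximal rank and a vanishing `X`-block of `H⁺`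
    (∀ X : Matrix k m ℂ,
      (MatrixCompletion.IsMaximalRank₃ (MatrixCompletion.herm₃ A B C D E X) ∧
        ∀ (i : k) (j : m),
          MatrixCompletion.pinv (MatrixCompletion.herm₃ A B C D E X)
            (Sum.inl i) (Sum.inr (Sum.inr j)) = 0) ↔
      X = B * MatrixCompletion.pinv C * D) ∧
    -- the block formula for `H⁺`, where `S` is `H[α]/C` and `T` is `H[β]/C`
    (∀ (S : Matrix k k ℂ) (T : Matrix m m ℂ) (G : Matrix l l ℂ),
      S = MatrixCompletion.schurCompl C Bᴴ B A →
      T = MatrixCompletion.schurCompl C D Dᴴ E →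
      G = MatrixCompletion.pinv C →
      MatrixCompletion.pinv (MatrixCompletion.herm₃ A B C D E (B * G * D)) =
        MatrixCompletion.blocks₃
          (MatrixCompletion.pinv S)
          (-(MatrixCompletion.pinv S * B * G))
          0
          (-(G * Bᴴ * MatrixCompletion.pinv S))
          (G + G * Bᴴ * MatrixCompletion.pinv S * B * G
            + G * D * MatrixCompletion.pinv T * Dᴴ * G)
          (-(G * D * MatrixCompletion.pinv T))
          0
          (-(MatrixCompletion.pinv T * Dᴴ * G))
          (MatrixCompletion.pinv T)) := by
  open MatrixCompletion in
  have hA := (isHermitian_of_herm₂ hα.isHermitian).1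
  have hC := (isHermitian_of_herm₂ hα.isHermitian).2
  have hE := (isHermitian_of_herm₂ hβ.isHermitian).2
  have hG := isHermitian_pinv hC
  have hγ := posSemidef_herm₂_swap hβ
  have hγ' := isMaximalRank₂_herm₂_swap hβ'
  have hSpos := posSemidef_schurCompl hα hα'
  have hTpos := posSemidef_schurCompl hγ hγ'
  have hSA := pinv_schurCompl_mul hC hα'
  have hTE := pinv_schurCompl_mul hC hγ'
  have hBC := mul_pinv_mul_of_isMaximalRank₂ hα'
  have hCD := mul_pinv_mul_conjTranspose_of_isMaximalRank₂ hC hγ'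
  have hDE := mul_pinv_mul_of_isMaximalRank₂ hβ'
  have hAB := mul_pinv_mul_conjTranspose_of_isMaximalRank₂ hA (isMaximalRank₂_herm₂_swap hα')
  have hED := mul_pinv_mul_conjTranspose_of_isMaximalRank₂ hE hβ'
  rw [Matrix.conjTranspose_conjTranspose] at hTpos hTE hCD hAB
  -- Equal kernels turn A A⁺ B = B into S S⁺ B = B; the next line does the same for E and T.
  rw [mul_pinv_comm hA, ← hSA, ← mul_pinv_comm hSpos.isHermitian, Matrix.mul_assoc] at hAB
  rw [mul_pinv_comm hE, ← hTE, ← mul_pinv_comm hTpos.isHermitian, Matrix.mul_assoc] at hED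
  rw [Matrix.mul_assoc] at hCD
  have hS : schurCompl C Bᴴ B A + B * pinv C * Bᴴ = A := sub_add_cancel _ _
  have hT : schurCompl C D Dᴴ E + Dᴴ * pinv C * D = E := sub_add_cancel _ _
  have hCpos : C.PosSemidef := by
    exact hβ.submatrix (Sum.inl : l → l ⊕ m)
  have hMP := isMoorePenrose_completionPinv hSpos.isHermitian hC hTpos.isHermitian hAB hBC hED hCD
  have hPos := posSemidef_completion hSpos hCpos hTpos hG hBC hCD
  rw [hS, hT] at hMP hPos
  refine ⟨hPos, fun X => ⟨fun ⟨h, h0⟩ =>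
    eq_of_isMaximalRank₃ hA hC hE hBC hCD hG rfl hDE h h0, ?_⟩, ?_⟩
  · rintro rfl
    have hprod := completion_mul_completionPinv hC hG hAB hBC hED hCD
    -- All the factors are Hermitian, so each MM⁺ becomes M⁺M, and S, T are traded for A, E.
    rw [hS, hT, ← pinv_eq hMP, mul_pinv_comm hPos.isHermitian, mul_pinv_comm hSpos.isHermitian,
      mul_pinv_comm hTpos.isHermitian, mul_pinv_comm hC, hSA, hTE] at hprod
    refine ⟨isMaximalRank₃_of_pinv_mul hprod, fun i j => ?_⟩
    rw [pinv_eq hMP]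
    rfl
  · rintro S T G rfl rfl rfl
    exact pinv_eq hMP
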